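/- Let $1\le k<n$, let $\mathcal Y=\{1,\dots,n\}$ with probability simplex $\Delta_{\mathcal Y}$, and write $v_{[i]}$ for the $i$-th largest entry of $v\in\mathbb R^n$. Let $$L_2(u,y)=\Bigl(1-u_y+\frac1k\sum_{i=1}^k (u-e_y)_{[i]}\Bigr)_+,\qquad u\in\mathbb R^n,\ y\in\mathcal Y .$$ For a loss $\ell:\mathcal R\times\mathcal Y\to\mathbb R_+$ and $p\in\Delta_{\mathcal Y}$ let $\mathrm{prop}[\ell](p)=\arg\min_{r\in\mathcal R}\sum_y p_y\,\ell(r,y)$. A set $\mathcal S\subseteq\mathcal R$ is representative for $\ell$ if $\mathrm{prop}[\ell](p)\cap\mathcal S\neq\emptyset$ for all $p\in\Delta_{\mathcal Y}$. A loss $L:\mathbb R^d\times\mathcal Y\to\mathbb R_+$ embeds a loss $\ell:\mathcal R\times\mathcal Y\to\mathbb R_+$ with $\mathcal R$ finite if there are a representative set $\mathcal S$ for $\ell$ and an injective map $\varphi:\mathcal S\to\mathbb R^d$ such that $L(\varphi(r),y)=\ell(r,y)$ for all $r\in\mathcal S$, $y\in\mathcal Y$, and $r\in\mathrm{prop}[\ell](p)\iff\varphi(r)\in\mathrm{prop}[L](p)$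 for all $r\in\mathcal S$, $p\in\Delta_{\mathcal Y}$. Let $\mathcal P_2$ be the set of pairs $(H,M)$ of disjoint subsets of $\mathcal Y$ with $|H\cup M|\le k$ and $|H|<k$; for $(H,M)\in\mathcal P_2$ put $$u_{H,M}=\frac{|M|+k-1}{k-|H|}\,\mathbf 1_H+\mathbf 1_M\in\mathbb R^n,\qquad R_2=\{u_{H,M}:(H,M)\in\mathcal P_2\},$$ and $$\hat\ell_2((H,M),y)=\begin{cases}0,& y\in H,\\[2pt] \dfrac{|H|+|M|-1}{k-|H|},& y\in M,\\[6pt] \dfrac{|H|+|M|-1}{k-|H|}+\dfrac{k+1}{k},&\text{otherwise.}\end{cases}$$ Then: 1. $R_2$ is a finite representative set for $L_2$; 2. $L_2$ embeds its restriction $L_2|_{R_2}$; 3. $L_2(u_{H,M},y)=\hat\ell_2((H,M),y)$ for all $(H,M)\in\mathcal P_2$ and $y\in\mathcal Y$; 4. $L_2$ embeds $\hat\ell_2:\mathcal P_2\times\mathcal Y\to\mathbb R_+$. -/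

import Mathlib

/-- The expected loss `𝔼_{Y ∼ p} ℓ(r, Y)` of the report `r`, for weights `p` on a finite label set. -/
def expectedLoss {R Y : Type*} [Fintype Y] (ℓ : R → Y → ℝ) (p : Y → ℝ) (r : R) : ℝ :=
  ∑ y, p y * ℓ r y

/-- The property elicited by the loss `ℓ`: the set of minimizers of the expected loss under `p`. -/
def elicitedProp {R Y : Type*} [Fintype Y] (ℓ : R → Y → ℝ) (p : Y → ℝ) : Set R :=
  {r | ∀ r' : R, expectedLoss ℓ p r ≤ expectedLoss ℓ p r'}

/-- `S` is representative for `ℓ`: for every label distribution, some element of `S` is optimal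
among all reports. -/
def IsRepresentative {R Y : Type*} [Fintype Y] (ℓ : R → Y → ℝ) (S : Set R) : Prop :=
  ∀ p ∈ stdSimplex ℝ Y, (elicitedProp ℓ p ∩ S).Nonempty

/-- The nonnegative loss `L` on `ℝᵈ` embeds the nonnegative discrete (finite report set)
loss `ℓ`. -/
def Embeds {R Y : Type*} [Fintype Y] {d : ℕ} (L : (Fin d → ℝ) → Y → ℝ) (ℓ : R → Y → ℝ) : Prop :=
  (∀ u y, 0 ≤ L u y) ∧ Finite R ∧ (∀ r y, 0 ≤ ℓ r y) ∧
    ∃ S : Set R, IsRepresentative ℓ S ∧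
      ∃ φ : S → (Fin d → ℝ), Function.Injective φ ∧
        (∀ (r : S) (y : Y), L (φ r) y = ℓ r y) ∧
        (∀ p ∈ stdSimplex ℝ Y, ∀ r : S, (r : R) ∈ elicitedProp ℓ p ↔ φ r ∈ elicitedProp L p)

/-- The restriction of a loss to a set of reports. -/
def restrictLoss {R Y : Type*} (L : R → Y → ℝ) (S : Set R) : S → Y → ℝ :=
  fun r y => L r y

/-- `sortedDesc u i` is the `(i+1)`-st largest entry of `u`, counted with multiplicity. -/
noncomputable def sortedDesc {n : ℕ} (u : Fin n → ℝ) (i : Fin n) : ℝ :=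
  u (Tuple.sort (fun j => -u j) i)

/-- The surrogate `L₂(u, y) = (1 - u_y + (1/k) ∑_{i=1}^k (u - e_y)_{[i]})₊`. -/
noncomputable def surrogateL2 (n k : ℕ) (u : Fin n → ℝ) (y : Fin n) : ℝ :=
  max (1 - u y + (1 / (k : ℝ)) *
    ∑ i : Fin n with i.val < k, sortedDesc (u - Pi.single y (1 : ℝ)) i) 0

/-- The pairs `(H, M)` of disjoint label sets with `|H ∪ M| ≤ k` and `|H| < k`. -/
abbrev HighMedium (n k : ℕ) : Type :=
  {r : Finset (Fin n) × Finset (Fin n) //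
    Disjoint r.1 r.2 ∧ (r.1 ∪ r.2).card ≤ k ∧ r.1.card < k}

/-- The discrete loss `ℓ̂₂`. -/
noncomputable def hatEll2 (n k : ℕ) (r : HighMedium n k) (y : Fin n) : ℝ :=
  if y ∈ r.1.1 then 0
  else if y ∈ r.1.2 then
    ((r.1.1.card : ℝ) + (r.1.2.card : ℝ) - 1) / ((k : ℝ) - (r.1.1.card : ℝ))
  else
    ((r.1.1.card : ℝ) + (r.1.2.card : ℝ) - 1) / ((k : ℝ) - (r.1.1.card : ℝ))
      + ((k : ℝ) + 1) / (k : ℝ)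

/-- The vector `((|M| + k - 1) / (k - |H|)) · 1_H + 1_M`. -/
noncomputable def vertexPoint (n k : ℕ) (r : HighMedium n k) : Fin n → ℝ :=
  (((r.1.2.card : ℝ) + (k : ℝ) - 1) / ((k : ℝ) - (r.1.1.card : ℝ))) •
      Set.indicator (r.1.1 : Set (Fin n)) (1 : Fin n → ℝ)
    + Set.indicator (r.1.2 : Set (Fin n)) (1 : Fin n → ℝ)

/-- The set `R₂` of all these vectors. -/
def vertexSetR2 (n k : ℕ) : Set (Fin n → ℝ) :=
  Set.range (vertexPoint n k)

/-! A direct computation gives `surrogateL2` = `hatEll2` at the vertices, so everything reduces to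
showing that no `u` has smaller expected loss than the best vertex (`le_expectedLoss_surrogateL2`).

Put w = (u - t)₊ with t the (k+1)-st largest entry of u, S = ∑ w and s = (S - 1)/k. The fractional
sets b = min(w, 1) and, for s > 0, a = min(1, (w - 1)₊/s) satisfy L₂(u, y) ≥ s(1 - a_y) +
((k+1)/k)(1 - b_y) and ∑ b - 1 ≤ s(k - ∑ a) (`exists_fractional_lower_bound`). Round a and b
independently to random sets H and B (`exists_rounding`). Since b = 1 wherever a ≠ 0, H ⊆ B almost
surely, so (H, B \ H) is a report whenever |H| < k. Averaging its optimality inequality with weight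
k - |H| clears the denominator of `hatEll2`; independence factors the expectations, and the bound
for u follows. -/

/-! ### Sums of the k largest entries. -/

/-- The sum of the `k` largest entries of `v`. -/
noncomputable def topSum {n : ℕ} (k : ℕ) (v : Fin n → ℝ) : ℝ :=
  ∑ i : Fin n with i.val < k, sortedDesc v i

lemma exists_topSum_eq {n k : ℕ} (hkn : k < n) (v : Fin n → ℝ) :
    ∃ (A : Finset (Fin n)) (j : Fin n), A.card = k ∧ j ∉ A ∧ (∀ i ∈ A, v j ≤ v i) ∧
      (∀ i ∉ A, v i ≤ v j) ∧ topSum k v = ∑ i ∈ A, v i := by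
  set σ := Tuple.sort (fun j => -v j) with hσ
  have hmono : Monotone ((fun j => -v j) ∘ σ) := Tuple.monotone_sort _
  have hle : ∀ i j : Fin n, i ≤ j → v (σ j) ≤ v (σ i) := fun i j hij => by
    have := hmono hij
    simpa using this
  refine ⟨(Finset.univ.filter fun i : Fin n => i.val < k).map σ.toEmbedding, σ ⟨k, hkn⟩,
    ?_, ?_, ?_, ?_, ?_⟩
  · rw [Finset.card_map, Fin.card_filter_val_lt]
    exact min_eq_right hkn.le
  · simp
  · intro i hi
    obtain ⟨x, hx, rfl⟩ := Finset.mem_map.1 hi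
    exact hle _ _ (Fin.le_def.2 (Finset.mem_filter.1 hx).2.le)
  · intro i hi
    obtain ⟨x, rfl⟩ := σ.surjective i
    refine hle _ _ (Fin.le_def.2 (not_lt.1 fun h => hi ?_))
    exact Finset.mem_map.2 ⟨x, by simpa using h, rfl⟩
  · rw [Finset.sum_map]
    rfl

lemma sum_le_topSum {n k : ℕ} (hkn : k < n) (v : Fin n → ℝ) (B : Finset (Fin n))
    (hB : B.card = k) : ∑ i ∈ B, v i ≤ topSum k v := by
  obtain ⟨A, j, hA, -, h1, h2, h3⟩ := exists_topSum_eq hkn v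
  -- Subtracting the threshold `v j` shifts both k-element sums equally and makes A the exact
  -- support of the positive part.
  have hBle : ∑ i ∈ B, (v i - v j) ≤ ∑ i ∈ B, max (v i - v j) 0 :=
    Finset.sum_le_sum fun i _ => le_max_left _ _
  have hU : ∑ i ∈ B, max (v i - v j) 0 ≤ ∑ i, max (v i - v j) 0 :=
    Finset.sum_le_sum_of_subset_of_nonneg (Finset.subset_univ _) fun i _ _ => le_max_right _ _
  have hAeq : ∑ i, max (v i - v j) 0 = ∑ i ∈ A, (v i - v j) := by
    rw [← Finset.sum_subset (Finset.subset_univ A) fun i _ hi =>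
      max_eq_right (sub_nonpos.2 (h2 i hi))]
    exact Finset.sum_congr rfl fun i hi => max_eq_left (sub_nonneg.2 (h1 i hi))
  have := hBle.trans (hU.trans_eq hAeq)
  simp only [Finset.sum_sub_distrib, Finset.sum_const, hA, hB] at this
  linarith

lemma topSum_le_sum_max {n k : ℕ} (hkn : k < n) (v : Fin n → ℝ) :
    topSum k v ≤ ∑ i, max (v i) 0 := by
  obtain ⟨A, j, -, -, -, -, h⟩ := exists_topSum_eq hkn v
  rw [h]
  exact (Finset.sum_le_sum fun i _ => le_max_left _ _).trans
    (Finset.sum_le_sum_of_subset_of_nonneg (Finset.subset_univ _) fun i _ _ => le_max_right _ _)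

/-- Evaluates `topSum` without sorting: a sign pattern certifies that A is optimal. -/
lemma topSum_eq_sum_max {n k : ℕ} (hkn : k < n) (v : Fin n → ℝ) (A : Finset (Fin n))
    (hA : A.card = k) (h1 : ∀ i ∈ A, 0 ≤ v i) (h2 : ∀ i ∉ A, v i ≤ 0) :
    topSum k v = ∑ i ∈ A, v i := by
  refine le_antisymm ((topSum_le_sum_max hkn v).trans_eq ?_) (sum_le_topSum hkn v A hA)
  rw [← Finset.sum_subset (Finset.subset_univ A) fun i _ hi => max_eq_right (h2 i hi)]
  exact Finset.sum_congr rfl fun i hi => max_eq_left (h1 i hi)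

lemma surrogateL2_eq {n k : ℕ} (u : Fin n → ℝ) (y : Fin n) :
    surrogateL2 n k u y =
      max (1 - u y + (1 / (k : ℝ)) * topSum k (u - Pi.single y (1 : ℝ))) 0 := rfl

lemma surrogateL2_nonneg {n k : ℕ} (u : Fin n → ℝ) (y : Fin n) : 0 ≤ surrogateL2 n k u y :=
  le_max_right _ _

/-- Independent rounding: a point of the unit cube is the mean of a random subset. -/
lemma exists_rounding {ι : Type*} [Fintype ι] [DecidableEq ι] (a : ι → ℝ)
    (h0 : ∀ i, 0 ≤ a i) (h1 : ∀ i, a i ≤ 1) :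
    ∃ w : Finset ι → ℝ, (∀ B, 0 ≤ w B) ∧ ∑ B, w B = 1 ∧
      (∀ y, ∑ B, w B * (if y ∈ B then 0 else 1) = 1 - a y) ∧
      ∑ B, w B * (B.card : ℝ) = ∑ i, a i ∧
      ∀ B, w B ≠ 0 → (∀ y, a y = 1 → y ∈ B) ∧ ∀ y ∈ B, a y ≠ 0 := by
  set w : Finset ι → ℝ := fun B => (∏ i ∈ B, a i) * ∏ i ∈ Finset.univ \ B, (1 - a i) with hw
  have hsum : ∑ B, w B = 1 := by
    have := Finset.prod_add a (fun i => 1 - a i) Finset.univ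
    simp only [add_sub_cancel, Finset.prod_const_one, Finset.powerset_univ] at this
    exact this.symm
  have hmarg : ∀ y, ∑ B, w B * (if y ∈ B then 0 else 1) = 1 - a y := by
    intro y
    -- Replacing `a y` by 0 kills exactly the subsets containing y in the expansion.
    have := Finset.prod_add (Function.update a y 0) (fun i => 1 - a i) Finset.univ
    rw [Finset.powerset_univ] at this
    have hl : ∏ i, (Function.update a y 0 i + (1 - a i)) = 1 - a y := by
      rw [Finset.prod_eq_single y]
      · simp
      · intro b _ hb
        simp [Function.update_of_ne hb]
      · simp
    rw [← hl, this]
    refine Finset.sum_congr rfl fun B _ => ?_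
    by_cases hy : y ∈ B
    · rw [Finset.prod_eq_zero hy (by simp)]
      simp [hy]
    · simp only [hy, if_false, mul_one, hw]
      congr 1
      refine Finset.prod_congr rfl fun i hi => ?_
      rw [Function.update_of_ne]
      rintro rfl
      exact hy hi
  refine ⟨w, fun B => mul_nonneg (Finset.prod_nonneg fun i _ => h0 i)
    (Finset.prod_nonneg fun i _ => sub_nonneg.2 (h1 i)), hsum, hmarg, ?_, ?_⟩
  · have hmem : ∀ y, ∑ B, w B * (if y ∈ B then 1 else 0) = a y := by
      intro y
      have h2 : ∑ B, w B * (if y ∈ B then 1 else 0)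
          = ∑ B, w B - ∑ B, w B * (if y ∈ B then 0 else 1) := by
        rw [← Finset.sum_sub_distrib]
        refine Finset.sum_congr rfl fun B _ => ?_
        split_ifs <;> ring
      rw [h2, hsum, hmarg]
      ring
    rw [← Finset.sum_congr rfl fun y _ => hmem y, Finset.sum_comm]
    refine Finset.sum_congr rfl fun B _ => ?_
    rw [← Finset.mul_sum]
    simp
  · intro B hB
    refine ⟨fun y hy => ?_, fun y hy h => hB ?_⟩
    · by_contra hyB
      refine hB (mul_eq_zero_of_right _ (Finset.prod_eq_zero (i := y) ?_ ?_))
      · simpa using hyB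
      · rw [hy, sub_self]
    · exact mul_eq_zero_of_left (Finset.prod_eq_zero hy h) _

/-! ### Values of the surrogate at the vertices. -/

lemma hatEll2_eq {n k : ℕ} (r : HighMedium n k) (y : Fin n) :
    hatEll2 n k r y =
      (((r.1.1 ∪ r.1.2).card : ℝ) - 1) / ((k : ℝ) - (r.1.1.card : ℝ)) *
        (if y ∈ r.1.1 then 0 else 1)
      + ((k : ℝ) + 1) / k * (if y ∈ r.1.1 ∪ r.1.2 then 0 else 1) := by
  rw [Finset.card_union_of_disjoint r.2.1]
  unfold hatEll2
  by_cases h1 : y ∈ r.1.1 <;> by_cases h2 : y ∈ r.1.2 <;> simp [h1, h2]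

lemma surrogateL2_vertexPoint {n k : ℕ} (hk : 1 ≤ k) (hkn : k < n) (r : HighMedium n k)
    (y : Fin n) : surrogateL2 n k (vertexPoint n k r) y = hatEll2 n k r y := by
  obtain ⟨⟨H, M⟩, hd, hc, hH⟩ := r
  simp only at hd hc hH
  set c : ℝ := ((M.card : ℝ) + k - 1) / ((k : ℝ) - H.card) with hcdef
  have hk0 : (1 : ℝ) ≤ k := by exact_mod_cast hk
  have hkh : (0 : ℝ) < (k : ℝ) - H.card := sub_pos.2 (by exact_mod_cast hH)
  have hck : c * ((k : ℝ) - H.card) = M.card + k - 1 := div_mul_cancel₀ _ hkh.ne'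
  have hu : ∀ i, vertexPoint n k ⟨(H, M), hd, hc, hH⟩ i =
      c * (if i ∈ H then 1 else 0) + (if i ∈ M then 1 else 0) := fun i => by
    simp [vertexPoint, Set.indicator_apply, hcdef]
  set u := vertexPoint n k ⟨(H, M), hd, hc, hH⟩
  have hc0 : 0 ≤ c := div_nonneg (by linarith [(Nat.cast_nonneg M.card : (0 : ℝ) ≤ M.card)]) hkh.le
  have hu0 : ∀ i, 0 ≤ u i := fun i => by
    rw [hu]; split_ifs <;> simp [hc0, add_nonneg]
  have huout : ∀ i ∉ H ∪ M, u i = 0 := fun i hi => by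
    rw [Finset.mem_union, not_or] at hi
    rw [hu]; simp [hi.1, hi.2]
  have hc1 : ∀ i ∈ H, 1 ≤ c := fun i hi => by
    have : (1 : ℝ) ≤ H.card := by exact_mod_cast Finset.card_pos.2 ⟨i, hi⟩
    rw [hcdef, le_div_iff₀ hkh]
    linarith [(Nat.cast_nonneg M.card : (0 : ℝ) ≤ M.card)]
  have hsum : ∀ A, H ∪ M ⊆ A → ∑ i ∈ A, u i = c * H.card + M.card := fun A hA => by
    simp only [hu, Finset.sum_add_distrib, ← Finset.mul_sum, Finset.sum_ite_mem]
    rw [Finset.inter_eq_right.2 (Finset.subset_union_left.trans hA),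
      Finset.inter_eq_right.2 (Finset.subset_union_right.trans hA)]
    simp
  rw [surrogateL2_eq]
  by_cases hy : y ∈ H ∪ M
  · obtain ⟨A, hA, -, hAc⟩ := Finset.exists_subsuperset_card_eq (Finset.subset_univ (H ∪ M)) hc
      (by simpa using hkn.le)
    have hu1 : 1 ≤ u y := by
      rw [hu]
      rcases Finset.mem_union.1 hy with h | h
      · simp [h, Finset.disjoint_left.1 hd h, hc1 y h]
      · simp [h, Finset.disjoint_right.1 hd h]
    have hT : topSum k (u - Pi.single y (1 : ℝ)) = c * H.card + M.card - 1 := by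
      rw [topSum_eq_sum_max hkn _ A hAc, ← hsum A hA]
      · simp [Finset.sum_sub_distrib, hA hy]
      · intro i _
        rw [Pi.sub_apply]
        rcases eq_or_ne i y with rfl | h
        · simpa using hu1
        · simpa [h] using hu0 i
      · intro i hi
        have h : i ≠ y := fun h => hi (h ▸ hA hy)
        simp [h, huout i fun h' => hi (hA h')]
    -- The coefficient c solves c(k - |H|) = |M| + k - 1, which makes the loss vanish on H.
    have hval : 1 / (k : ℝ) * (c * H.card + M.card - 1) = c - 1 := by
      field_simp
      linarith
    rw [hT, hval, hu]
    rcases Finset.mem_union.1 hy with h | h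
    · simp [hatEll2, h, Finset.disjoint_left.1 hd h]
    · have hM : (1 : ℝ) ≤ M.card := by exact_mod_cast Finset.card_pos.2 ⟨y, h⟩
      have : c - 1 = ((H.card : ℝ) + M.card - 1) / ((k : ℝ) - H.card) := by
        rw [hcdef]; field_simp; ring
      have hnn : 0 ≤ c - 1 := by
        rw [this]
        exact div_nonneg (by linarith [(Nat.cast_nonneg H.card : (0 : ℝ) ≤ H.card)]) hkh.le
      simp only [hatEll2, h, Finset.disjoint_right.1 hd h, if_true, if_false]
      rw [← this, max_eq_left (by linarith)]
      ring
  -- Since k < n, H ∪ M can be padded to k labels avoiding y, so subtracting 1 at y does not affect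
  -- the sum.
  · obtain ⟨A, hA, hA2, hAc⟩ := Finset.exists_subsuperset_card_eq
      (Finset.subset_erase.2 ⟨Finset.subset_univ (H ∪ M), hy⟩) hc
      (by rw [Finset.card_erase_of_mem (Finset.mem_univ y), Finset.card_univ, Fintype.card_fin]
          omega)
    have hyA : y ∉ A := fun h => Finset.notMem_erase _ _ (hA2 h)
    have hT : topSum k (u - Pi.single y (1 : ℝ)) = c * H.card + M.card := by
      rw [topSum_eq_sum_max hkn _ A hAc, ← hsum A hA]
      · simp [Finset.sum_sub_distrib, hyA]
      · intro i hi
        have h : i ≠ y := fun h => hyA (h ▸ hi)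
        simpa [h] using hu0 i
      · intro i hi
        rw [Pi.sub_apply, huout i fun h' => hi (hA h')]
        rcases eq_or_ne i y with rfl | h
        · simp
        · simp [h]
    have hy' := hy
    rw [Finset.mem_union, not_or] at hy'
    have hval : 1 / (k : ℝ) * (c * H.card + M.card) = c - 1 + 1 / k := by
      field_simp
      linarith
    have : c - 1 = ((H.card : ℝ) + M.card - 1) / ((k : ℝ) - H.card) := by
      rw [hcdef]; field_simp; ring
    have hk1 : ((k : ℝ) + 1) / k = 1 + 1 / k := by field_simp
    have hkp : (0 : ℝ) < 1 / k := by positivity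
    rw [hT, hval, huout y hy]
    simp only [hatEll2, hy'.1, hy'.2, if_false]
    rw [← this, hk1, max_eq_left (by linarith)]
    ring

/-! ### Optimality of the vertices by fractional relaxation and rounding. -/

/-- A lower bound on all the losses of a report, in terms of a fractional high set `a` and a
fractional high-or-medium set `b`. -/
lemma exists_fractional_lower_bound {n k : ℕ} (hk : 1 ≤ k) (hkn : k < n) (u : Fin n → ℝ) :
    ∃ (a b : Fin n → ℝ) (s : ℝ) (A : Finset (Fin n)), A.card = k ∧
      (∀ i, 0 ≤ a i ∧ a i ≤ 1) ∧ (∀ i, 0 ≤ b i ∧ b i ≤ 1) ∧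
      (∀ i, a i ≠ 0 → b i = 1 ∧ 0 < s) ∧ (∀ i ∉ A, b i = 0) ∧
      ∑ i, b i - 1 ≤ s * ((k : ℝ) - ∑ i, a i) ∧
      ∀ y, s * (1 - a y) + ((k : ℝ) + 1) / k * (1 - b y) ≤ surrogateL2 n k u y := by
  obtain ⟨A, j, hA, hj, h1, h2, -⟩ := exists_topSum_eq hkn u
  have hk0 : (0 : ℝ) < k := by exact_mod_cast hk
  set w : Fin n → ℝ := fun i => max (u i - u j) 0 with hw
  have hw0 : ∀ i, 0 ≤ w i := fun i => le_max_right _ _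
  have hwA : ∀ i ∈ A, w i = u i - u j := fun i hi => max_eq_left (sub_nonneg.2 (h1 i hi))
  have hwA' : ∀ i ∉ A, w i = 0 := fun i hi => max_eq_right (sub_nonpos.2 (h2 i hi))
  set S := ∑ i, w i with hS
  have hSA : ∑ i ∈ A, u i = S + k * u j := by
    rw [hS, ← Finset.sum_subset (Finset.subset_univ A) fun i _ hi => hwA' i hi,
      Finset.sum_congr rfl hwA, Finset.sum_sub_distrib, Finset.sum_const, hA]
    simp
  set s := (S - 1) / k with hs
  have hks : k * s = S - 1 := by rw [hs]; field_simp
  set a : Fin n → ℝ := fun i => if 0 < s then min 1 (max (w i - 1) 0 / s) else 0 with ha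
  have ha01 : ∀ i, 0 ≤ a i ∧ a i ≤ 1 := fun i => by
    simp only [ha]
    split_ifs with h
    · exact ⟨le_min zero_le_one (div_nonneg (le_max_right _ _) h.le), min_le_left _ _⟩
    · simp
  have hsa : ∀ i, s * a i ≤ max (w i - 1) 0 := fun i => by
    simp only [ha]
    split_ifs with h
    · calc s * min 1 (max (w i - 1) 0 / s) ≤ s * (max (w i - 1) 0 / s) :=
            mul_le_mul_of_nonneg_left (min_le_right _ _) h.le
        _ = _ := mul_div_cancel₀ _ h.ne'
    · simp
  refine ⟨a, fun i => min (w i) 1, s, A, hA, ha01,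
    fun i => ⟨le_min (hw0 i) zero_le_one, min_le_right _ _⟩, ?_, ?_, ?_, ?_⟩
  · intro i hi
    simp only [ha] at hi
    split_ifs at hi with h
    · refine ⟨min_eq_right (le_of_not_gt fun hlt => hi ?_), h⟩
      rw [max_eq_right (by linarith)]
      simp
    · exact absurd rfl hi
  · intro i hi
    simp [hwA' i hi]
  -- Termwise, s·a ≤ (w - 1)₊ and (w - 1)₊ + min(w, 1) = w.
  · have : ∑ i, (s * a i + min (w i) 1) ≤ S := by
      refine Finset.sum_le_sum fun i _ => ?_
      have := hsa i
      rcases le_total (w i) 1 with h | h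
      · rw [max_eq_right (by linarith)] at this
        rw [min_eq_left h]; linarith
      · rw [max_eq_left (by linarith)] at this
        rw [min_eq_right h]; linarith
    rw [Finset.sum_add_distrib, ← Finset.mul_sum] at this
    linarith
  · intro y
    have hk1 : ((k : ℝ) + 1) / k = 1 + 1 / k := by field_simp
    have hlow : s * (1 - a y) + ((k : ℝ) + 1) / k * (1 - min (w y) 1) ≤
        max (1 - w y + 1 / k * (S - min (w y) 1)) 0 := by
      have hs' : s = 1 / k * (S - 1) := by rw [hs]; ring
      rcases le_total (w y) 1 with h | h
      · have hay : a y = 0 := by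
          simp only [ha]
          split_ifs
          · rw [max_eq_right (by linarith)]; simp
          · rfl
        refine le_max_of_le_left (le_of_eq ?_)
        rw [hay, min_eq_left h, hk1, hs']
        ring
      · rw [min_eq_right h, sub_self, mul_zero, add_zero, ← hs']
        by_cases hsp : 0 < s
        · have : a y = min 1 ((w y - 1) / s) := by
            simp only [ha, if_pos hsp, max_eq_left (sub_nonneg.2 h)]
          rw [this]
          rcases min_cases 1 ((w y - 1) / s) with ⟨h', -⟩ | ⟨h', -⟩
          · rw [h']; exact le_max_of_le_right (by simp)
          · rw [h']
            refine le_max_of_le_left (le_of_eq ?_)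
            field_simp
            ring
        · refine le_max_of_le_right ?_
          have : a y = 0 := by simp only [ha, if_neg hsp]
          rw [this]; linarith
    refine hlow.trans ?_
    rw [surrogateL2_eq]
    refine max_le_max ?_ le_rfl
    have hinv : (0 : ℝ) ≤ 1 / k := by positivity
    have hjk : 1 / (k : ℝ) * (k * u j) = u j := by field_simp
    have main : ∀ x, S + k * u j - x ≤ topSum k (u - Pi.single y (1 : ℝ)) →
        u j + 1 / k * (S - x) ≤ 1 / k * topSum k (u - Pi.single y (1 : ℝ)) := fun x hx => by
      have := mul_le_mul_of_nonneg_left hx hinv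
      linarith
    have hAsum := sum_le_topSum hkn (u - Pi.single y (1 : ℝ)) A hA
    simp only [Pi.sub_apply, Finset.sum_sub_distrib, Finset.sum_pi_single', hSA] at hAsum
    by_cases hy : y ∈ A
    · rw [if_pos hy] at hAsum
      have hm : S + k * u j - min (w y) 1 ≤ topSum k (u - Pi.single y (1 : ℝ)) := by
        rcases min_cases (w y) 1 with ⟨h', -⟩ | ⟨h', -⟩
        -- When w_y ≤ 1, subtracting 1 brings y down to the threshold or below, so j replaces it.
        · have hcard : (insert j (A.erase y)).card = k := by
            rw [Finset.card_insert_of_notMem fun h => hj (Finset.mem_of_mem_erase h),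
              Finset.card_erase_add_one hy, hA]
          have hB := sum_le_topSum hkn (u - Pi.single y (1 : ℝ)) _ hcard
          have hyB : y ∉ insert j (A.erase y) := by
            simp only [Finset.mem_insert, Finset.notMem_erase, or_false]
            rintro rfl
            exact hj hy
          simp only [Pi.sub_apply, Finset.sum_sub_distrib, Finset.sum_pi_single', hyB, if_false]
            at hB
          rw [Finset.sum_insert fun h => hj (Finset.mem_of_mem_erase h)] at hB
          have he := Finset.add_sum_erase A u hy
          rw [h', hwA y hy]
          linarith
        · rw [h']; exact hAsum
      have := main _ hm
      rw [hwA y hy] at this ⊢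
      linarith
    · rw [if_neg hy] at hAsum
      have := main 0 hAsum
      rw [hwA' y hy, min_eq_left zero_le_one]
      linarith [h2 y hy]

lemma le_expectedLoss_surrogateL2 {n k : ℕ} (hk : 1 ≤ k) (hkn : k < n) {p : Fin n → ℝ}
    (hp : p ∈ stdSimplex ℝ (Fin n)) (V : ℝ)
    (hV : ∀ r : HighMedium n k, V ≤ expectedLoss (hatEll2 n k) p r) (u : Fin n → ℝ) :
    V ≤ expectedLoss (surrogateL2 n k) p u := by
  obtain ⟨a, b, s, A, hA, ha, hb, hab, hbA, hsab, hL⟩ := exists_fractional_lower_bound hk hkn u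
  have hk0 : (0 : ℝ) < k := by exact_mod_cast hk
  have haA : ∀ i ∉ A, a i = 0 := fun i hi => by
    by_contra h
    exact one_ne_zero ((hab i h).1.symm.trans (hbA i hi))
  have hsaA : ∑ i, a i = ∑ i ∈ A, a i :=
    (Finset.sum_subset (Finset.subset_univ A) fun i _ hi => haA i hi).symm
  have hα : ∑ i, a i ≤ k := by
    rw [hsaA]
    calc ∑ i ∈ A, a i ≤ ∑ i ∈ A, (1 : ℝ) := Finset.sum_le_sum fun i _ => (ha i).2
      _ = k := by simp [hA]
  have hstep : ∀ f : Fin n → ℝ, (∀ y, f y ≤ surrogateL2 n k u y) →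
      ∑ y, p y * f y ≤ expectedLoss (surrogateL2 n k) p u := fun f hf =>
    Finset.sum_le_sum fun y _ => mul_le_mul_of_nonneg_left (hf y) (hp.1 y)
  rcases hα.eq_or_lt with hα | hα
  -- If ∑ a = k, the averaging weight k - ∑ a vanishes. Then a = b = 1 on A, which forces k = 1, and
  -- the report (∅, A) is used directly.
  · have ha1 : ∀ i ∈ A, a i = 1 := by
      have h : ∑ i ∈ A, a i = ∑ i ∈ A, (1 : ℝ) := by rw [← hsaA, hα]; simp [hA]
      exact (Finset.sum_eq_sum_iff_of_le fun i _ => (ha i).2).1 h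
    have hb1 : ∀ i ∈ A, b i = 1 := fun i hi => (hab i (by simp [ha1 i hi])).1
    have hsb : ∑ i, b i = k := by
      rw [← Finset.sum_subset (Finset.subset_univ A) fun i _ hi => hbA i hi,
        Finset.sum_congr rfl hb1]
      simp [hA]
    rw [hsb, hα, sub_self, mul_zero] at hsab
    have hk1 : k = 1 := le_antisymm (by exact_mod_cast sub_nonpos.1 hsab) hk
    obtain ⟨i, hi⟩ : A.Nonempty := Finset.card_pos.1 (by omega)
    have hspos : 0 < s := (hab i (by simp [ha1 i hi])).2
    let r : HighMedium n k := ⟨(∅, A), by simp, by simp [hA], by simpa using Nat.pos_of_ne_zero (by omega)⟩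
    refine (hV r).trans (hstep _ fun y => le_trans ?_ (hL y))
    by_cases hy : y ∈ A
    · simp [hatEll2, r, hy, hA, hk1, ha1, hb1]
    · simp [hatEll2, r, hy, hA, hk1, haA, hbA, hspos.le]
  · obtain ⟨wa, wa0, wa1, wam, wac, was⟩ := exists_rounding a (fun i => (ha i).1)
      fun i => (ha i).2
    obtain ⟨wb, wb0, wb1, wbm, wbc, wbs⟩ := exists_rounding b (fun i => (hb i).1)
      fun i => (hb i).2
    have hden : 0 < (k : ℝ) - ∑ i, a i := sub_pos.2 hα
    set κ : ℝ := ((k : ℝ) + 1) / k with hκ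
    have hκ0 : 0 ≤ κ := by positivity
    have hpair : ∀ H B, wa H * wb B * (((k : ℝ) - H.card) * V) ≤
        wa H * wb B * ∑ y, p y * (((B.card : ℝ) - 1) * (if y ∈ H then 0 else 1)
          + ((k : ℝ) - H.card) * κ * (if y ∈ B then 0 else 1)) := by
      intro H B
      rcases eq_or_ne (wa H) 0 with hH | hH
      · simp [hH]
      rcases eq_or_ne (wb B) 0 with hB | hB
      · simp [hB]
      refine mul_le_mul_of_nonneg_left ?_ (mul_nonneg (wa0 H) (wb0 B))
      have hHB : H ⊆ B := fun i hi => (wbs B hB).1 i (hab i ((was H hH).2 i hi)).1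
      have hBA : B ⊆ A := fun i hi => by
        by_contra h
        exact (wbs B hB).2 i hi (hbA i h)
      have hBk : B.card ≤ k := hA ▸ Finset.card_le_card hBA
      rcases (le_trans (Finset.card_le_card hHB) hBk).eq_or_lt with hHk | hHk
      -- For |H| = k there is no report, but the left side is zero and |B| ≥ 1 makes the right side
      -- nonnegative.
      · have hB1 : (1 : ℝ) ≤ B.card := by
          have := Finset.card_le_card hHB
          exact_mod_cast (by omega : 1 ≤ B.card)
        rw [hHk, sub_self, zero_mul]
        refine Finset.sum_nonneg fun y _ => mul_nonneg (hp.1 y) ?_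
        split_ifs <;> simp [hB1]
      · have hun : H ∪ B \ H = B := Finset.union_sdiff_of_subset hHB
        let r : HighMedium n k := ⟨(H, B \ H), Finset.disjoint_sdiff, by rw [hun]; exact hBk, hHk⟩
        have hkH : (0 : ℝ) < (k : ℝ) - H.card := sub_pos.2 (by exact_mod_cast hHk)
        refine (mul_le_mul_of_nonneg_left (hV r) hkH.le).trans_eq ?_
        rw [expectedLoss, Finset.mul_sum]
        refine Finset.sum_congr rfl fun y _ => ?_
        rw [hatEll2_eq]
        simp only [r, hun]
        rw [← hκ]
        field_simp
    have hsum := Finset.sum_le_sum fun H (_ : H ∈ Finset.univ) =>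
      Finset.sum_le_sum fun B (_ : B ∈ Finset.univ) => hpair H B
    have hleft : ∑ H, ∑ B, wa H * wb B * (((k : ℝ) - H.card) * V)
        = ((k : ℝ) - ∑ i, a i) * V := by
      calc _ = ∑ H, (k * V * wa H - V * (wa H * H.card)) * ∑ B, wb B := by
            refine Finset.sum_congr rfl fun H _ => ?_
            rw [Finset.mul_sum]
            exact Finset.sum_congr rfl fun B _ => by ring
        _ = _ := by
            rw [wb1]
            simp only [mul_one, Finset.sum_sub_distrib, ← Finset.mul_sum, wa1, wac]
            ring
    have hright : ∑ H, ∑ B, wa H * wb B * ∑ y, p y * (((B.card : ℝ) - 1) *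
          (if y ∈ H then 0 else 1) + ((k : ℝ) - H.card) * κ * (if y ∈ B then 0 else 1))
        = ∑ y, p y * ((∑ i, b i - 1) * (1 - a y)
          + ((k : ℝ) - ∑ i, a i) * κ * (1 - b y)) := by
      -- Each summand is a function of H times a function of B, so its expectation factors.
      have hBm : ∑ B, (wb B * (B.card : ℝ) - wb B) = ∑ i, b i - 1 := by
        rw [Finset.sum_sub_distrib, wb1, wbc]
      have hHm : ∑ H, (wa H * k - wa H * (H.card : ℝ)) = k - ∑ i, a i := by
        rw [Finset.sum_sub_distrib, ← Finset.sum_mul, wa1, wac, one_mul]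
      have hy : ∀ y, p y * ((∑ i, b i - 1) * (1 - a y) + ((k : ℝ) - ∑ i, a i) * κ * (1 - b y))
          = ∑ H, ∑ B, wa H * wb B * (p y * (((B.card : ℝ) - 1) *
          (if y ∈ H then 0 else 1) + ((k : ℝ) - H.card) * κ * (if y ∈ B then 0 else 1))) := by
        intro y
        rw [← hBm, ← hHm, ← wam y, ← wbm y, mul_comm (∑ B, _) (∑ H, _), mul_right_comm,
          Finset.sum_mul_sum, Finset.sum_mul_sum, Finset.sum_mul, ← Finset.sum_add_distrib,
          Finset.mul_sum]
        refine Finset.sum_congr rfl fun H _ => ?_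
        rw [Finset.sum_mul, ← Finset.sum_add_distrib, Finset.mul_sum]
        exact Finset.sum_congr rfl fun B _ => by ring
      simp only [hy]
      symm
      rw [Finset.sum_comm]
      refine Finset.sum_congr rfl fun H _ => ?_
      rw [Finset.sum_comm]
      exact Finset.sum_congr rfl fun B _ => (Finset.mul_sum _ _ _).symm
    rw [hleft, hright] at hsum
    refine le_trans ?_ (hstep _ hL)
    refine le_of_mul_le_mul_left (hsum.trans ?_) hden
    rw [Finset.mul_sum]
    refine Finset.sum_le_sum fun y _ => ?_
    have h1 := mul_le_mul_of_nonneg_right hsab (sub_nonneg.2 (ha y).2)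
    calc _ ≤ p y * (s * ((k : ℝ) - ∑ i, a i) * (1 - a y)
          + ((k : ℝ) - ∑ i, a i) * κ * (1 - b y)) :=
        mul_le_mul_of_nonneg_left (by linarith) (hp.1 y)
      _ = _ := by ring

/-! ### Representativeness and embeddings. -/

lemma expectedLoss_vertexPoint {n k : ℕ} (hk : 1 ≤ k) (hkn : k < n) (p : Fin n → ℝ)
    (r : HighMedium n k) :
    expectedLoss (surrogateL2 n k) p (vertexPoint n k r) = expectedLoss (hatEll2 n k) p r := by
  simp only [expectedLoss, surrogateL2_vertexPoint hk hkn]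

lemma mem_elicitedProp_hatEll2_iff {n k : ℕ} (hk : 1 ≤ k) (hkn : k < n) {p : Fin n → ℝ}
    (hp : p ∈ stdSimplex ℝ (Fin n)) (r : HighMedium n k) :
    r ∈ elicitedProp (hatEll2 n k) p ↔
      vertexPoint n k r ∈ elicitedProp (surrogateL2 n k) p := by
  refine ⟨fun h u => ?_, fun h r' => ?_⟩
  · rw [expectedLoss_vertexPoint hk hkn]
    exact le_expectedLoss_surrogateL2 hk hkn hp _ h u
  · rw [← expectedLoss_vertexPoint hk hkn, ← expectedLoss_vertexPoint hk hkn]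
    exact h _

lemma elicitedProp_hatEll2_nonempty {n k : ℕ} (hk : 1 ≤ k) (p : Fin n → ℝ) :
    (elicitedProp (hatEll2 n k) p).Nonempty := by
  have : Nonempty (HighMedium n k) := ⟨⟨(∅, ∅), by simp, by simp, by simpa using Nat.pos_of_ne_zero (by omega)⟩⟩
  exact Finite.exists_min (expectedLoss (hatEll2 n k) p)

lemma isRepresentative_vertexSetR2 {n k : ℕ} (hk : 1 ≤ k) (hkn : k < n) :
    IsRepresentative (surrogateL2 n k) (vertexSetR2 n k) := fun p hp => by
  obtain ⟨r, hr⟩ := elicitedProp_hatEll2_nonempty hk p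
  exact ⟨_, (mem_elicitedProp_hatEll2_iff hk hkn hp r).1 hr, r, rfl⟩

lemma embeds_restrictLoss {d : ℕ} {Y : Type*} [Fintype Y] {L : (Fin d → ℝ) → Y → ℝ}
    {S : Set (Fin d → ℝ)} (hL : ∀ u y, 0 ≤ L u y) (hfin : S.Finite)
    (hS : IsRepresentative L S) : Embeds L (restrictLoss L S) := by
  refine ⟨hL, hfin.to_subtype, fun r y => hL r y, Set.univ, ?_, fun r => r.1.1,
    fun r r' h => Subtype.ext (Subtype.ext h), fun r y => rfl, ?_⟩
  · intro p hp
    obtain ⟨u, hu, huS⟩ := hS p hp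
    exact ⟨⟨u, huS⟩, fun r => hu r, trivial⟩
  · intro p hp r
    refine ⟨fun h u => ?_, fun h u => h u⟩
    obtain ⟨v, hv, hvS⟩ := hS p hp
    exact (h ⟨v, hvS⟩).trans (hv u)

lemma embeds_hatEll2 {n k : ℕ} (hk : 1 ≤ k) (hkn : k < n) :
    Embeds (surrogateL2 n k) (hatEll2 n k) := by
  refine ⟨surrogateL2_nonneg, inferInstance, fun r y => ?_, ?_⟩
  · rw [← surrogateL2_vertexPoint hk hkn]
    exact surrogateL2_nonneg _ _
  -- `vertexPoint` need not be injective: for k ≥ 2, ({y}, ∅) and (∅, {y}) both give the basis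
  -- vector of y. S keeps one report per vertex.
  obtain ⟨S, hS⟩ := Set.exists_image_eq_and_injOn Set.univ (vertexPoint n k)
  rw [Set.image_univ] at hS
  refine ⟨S, fun p hp => ?_, fun r => vertexPoint n k r, hS.2.injective,
    fun r y => surrogateL2_vertexPoint hk hkn r y,
    fun p hp r => mem_elicitedProp_hatEll2_iff hk hkn hp r⟩
  obtain ⟨r, hr⟩ := elicitedProp_hatEll2_nonempty hk p
  obtain ⟨r', hr', he⟩ : vertexPoint n k r ∈ vertexPoint n k '' S := by
    rw [hS.1]; exact ⟨r, rfl⟩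
  refine ⟨r', ?_, hr'⟩
  rw [mem_elicitedProp_hatEll2_iff hk hkn hp] at hr ⊢
  rwa [he]

theorem mainTheorem7 (n k : ℕ) (hk : 1 ≤ k) (hkn : k < n) :
    (vertexSetR2 n k).Finite ∧
    IsRepresentative (surrogateL2 n k) (vertexSetR2 n k) ∧
    Embeds (surrogateL2 n k) (restrictLoss (surrogateL2 n k) (vertexSetR2 n k)) ∧
    (∀ (r : HighMedium n k) (y : Fin n),
      surrogateL2 n k (vertexPoint n k r) y = hatEll2 n k r y) ∧
    Embeds (surrogateL2 n k) (hatEll2 n k) := by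
  have hfin : (vertexSetR2 n k).Finite := Set.finite_range _
  have hrep := isRepresentative_vertexSetR2 hk hkn
  exact ⟨hfin, hrep, embeds_restrictLoss surrogateL2_nonneg hfin hrep,
    surrogateL2_vertexPoint hk hkn, embeds_hatEll2 hk hkn⟩
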